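/- Let $\alpha\in(0,1]$ and $\mu>0$. For $\eta,\nu,\tau>0$ and $w\in\mathbb R$ let $$E_{\eta,\nu}^{\tau}(w)=\sum_{j=0}^{\infty}\frac{(\tau)_j}{j!\,\Gamma(\eta j+\nu)}\,w^j,\qquad (\tau)_j=\frac{\Gamma(\tau+j)}{\Gamma(\tau)},$$ be the generalized Mittag-Leffler function. A random variable $X$ with values in $\mathbb N=\{0,1,2,\dots\}$ has the generalized fractional Poisson distribution gfPd$(\alpha,\beta,\delta,\mu)$, where $\alpha,\beta\in(0,1]$ and $\delta\in(0,\beta/\alpha]$, if $$P(X=x)=\frac{\Gamma(\delta+x)}{x!\,\Gamma(\delta)}\,\mu^x\,\Gamma(\beta)\,E_{\alpha,\alpha x+\beta}^{\delta+x}(-\mu)\qquad\text{for all }x\in\mathbb N.$$ Let $X_{\alpha,\alpha}$ have the distribution gfPd$(\alpha,\alpha,1,\mu)$, and let $S$ be a positive $\alpha$-stable random variable with Laplace transform $\mathbf E[e^{-tS}]=\exp(-t^\alpha)$, $t\ge 0$ (for $\alpha=1$ this means $S=1$ almost surely), and with law $\nu_S$. Then for every $x\in\mathbb N$ the function $y\mapsto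 y^{-\alpha(x+1)}e^{-\mu y^{-\alpha}}$ is $\nu_S$-integrable on $(0,\infty)$ and $$P(X_{\alpha,\alpha}=x)=\Gamma(\alpha+1)\,\frac{\mu^x}{x!}\int_0^\infty y^{-\alpha(x+1)}\,e^{-\mu y^{-\alpha}}\,\nu_S(dy).$$ -/

import Mathlib

open MeasureTheory

/-- The generalized (three-parameter, Prabhakar) Mittag-Leffler function
`E_{η,ν}^τ(w) = ∑_{j ≥ 0} (τ)_j / (j! Γ(η j + ν)) w^j`, with `(τ)_j = Γ(τ + j) / Γ(τ)`,
for real parameters `η, ν, τ > 0` and real argument `w`. -/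
noncomputable def mittagLeffler (η ν τ w : ℝ) : ℝ :=
  ∑' j : ℕ, (Real.Gamma (τ + j) / Real.Gamma τ) /
    ((j.factorial : ℝ) * Real.Gamma (η * j + ν)) * w ^ j

/-- The mass at `x` of the generalized fractional Poisson distribution `gfPd(α, β, δ, μ)`. -/
noncomputable def gfPdMass (α β δ μ : ℝ) (x : ℕ) : ℝ :=
  Real.Gamma (δ + x) / ((x.factorial : ℝ) * Real.Gamma δ) * μ ^ x * Real.Gamma β *
    mittagLeffler α (α * x + β) (δ + x) (-μ)

/-- The random variable `X` on `(Ω, P)` has the distribution `gfPd(α, β, δ, μ)`. -/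
structure HasGfPd {Ω : Type*} [MeasurableSpace Ω] (X : Ω → ℕ) (P : Measure Ω)
    (α β δ μ : ℝ) : Prop where
  aemeasurable : AEMeasurable X P
  mass : ∀ x : ℕ, P.real {ω | X ω = x} = gfPdMass α β δ μ x

/-- The random variable `S` on `(Ω, P)` is positive `α`-stable, normalized so that its
Laplace transform is `E[exp (-t S)] = exp (-t ^ α)` for all `t ≥ 0`. -/
structure IsPositiveStable {Ω : Type*} [MeasurableSpace Ω] (S : Ω → ℝ) (P : Measure Ω)
    (α : ℝ) : Prop where
  aemeasurable : AEMeasurable S P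
  pos : ∀ᵐ ω ∂P, 0 < S ω
  laplace : ∀ t : ℝ, 0 ≤ t → ∫ ω, Real.exp (-(t * S ω)) ∂P = Real.exp (-(t ^ α))

/-! Expanding `exp (-μ y^(-α))` in powers of `y^(-α)` turns the integral into a series of negative
moments of `S`. To compute these, write `Γ(s) y^(-s) = ∫ t^(s-1) e^(-ty) dt` over `t > 0` and
integrate in `y` first: the Laplace transform leaves `∫ t^(s-1) e^(-t^α) dt = Γ(s/α)/α`. At `s =
α(x+1+j)` the numerator is `(x+j)!`, and the series is the Mittag-Leffler series up to constants.
Termwise integration is justified by `summable_factorial_mul_pow_div_Gamma`. -/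

/-- Truncating Euler's integral at `R` bounds `Γ` from below. -/
theorem Real.rpow_mul_exp_neg_le_Gamma {s R : ℝ} (hs : 1 ≤ s) (hR : 0 < R) :
    R ^ (s - 1) * Real.exp (-R) ≤ Real.Gamma s := by
  have hs0 : 0 < s := by linarith
  -- `exp (-R)` becomes the integral of `exp (-t)` over `t > R`, where `R^(s-1) ≤ t^(s-1)` because
  -- `s ≥ 1`.
  rw [Real.Gamma_eq_integral hs0, mul_comm, ← integral_exp_neg_Ioi R, ← integral_mul_const]
  have hint := Real.GammaIntegral_convergent hs0
  have hsub : Set.Ioi R ⊆ Set.Ioi 0 := Set.Ioi_subset_Ioi hR.le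
  refine le_trans (setIntegral_mono_on ((integrableOn_exp_neg_Ioi R).mul_const _)
    (hint.mono_set hsub) measurableSet_Ioi fun x hx => ?_)
    (setIntegral_mono_set hint ?_ hsub.eventuallyLE)
  · exact mul_le_mul_of_nonneg_left
      (Real.rpow_le_rpow hR.le (le_of_lt hx) (by linarith)) (Real.exp_nonneg _)
  · filter_upwards [ae_restrict_mem measurableSet_Ioi] with x hx
    exact mul_nonneg (Real.exp_nonneg _) (Real.rpow_nonneg (le_of_lt hx) _)

/-- The Mittag-Leffler coefficients `(x + j)! / (j! Γ(α (x + 1 + j)))` decay faster than any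
geometric sequence. -/
theorem summable_factorial_mul_pow_div_Gamma {α : ℝ} (hα : 0 < α) {μ : ℝ} (hμ : 0 < μ) (x : ℕ) :
    Summable fun j : ℕ => μ ^ j / (j.factorial : ℝ) *
      (((x + j).factorial : ℝ) / Real.Gamma (α * (x + 1 + j))) := by
  -- The bound on `Γ` yields a factor `(R^α)^j = (4μ)^j`, while `(x+j)!/j! ≤ 2^(x+j) x!` costs only
  -- `2^j`; the quotient with `μ^j` leaves ratio `1/2`.
  set R : ℝ := (4 * μ) ^ α⁻¹ with hRdef
  have hR : 0 < R := Real.rpow_pos_of_pos (by positivity) _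
  have hRα : R ^ α = 4 * μ := Real.rpow_inv_rpow (by positivity) hα.ne'
  set C : ℝ := (x.factorial : ℝ) * 2 ^ x * (Real.exp R * R ^ (1 - α * (x + 1))) with hC
  refine Summable.of_norm_bounded_eventually_nat (g := fun j => C * (1 / 2 : ℝ) ^ j)
    (summable_geometric_two.mul_left C) ?_
  -- From `j ≥ 1/α` on, the argument of `Γ` is at least `1`, as the truncation bound requires.
  obtain ⟨N, hN⟩ := exists_nat_ge α⁻¹
  filter_upwards [Filter.eventually_ge_atTop N] with j hj
  have hs : 1 ≤ α * (x + 1 + j) := by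
    have h1 : α⁻¹ ≤ x + 1 + j := by
      have : (N : ℝ) ≤ j := by exact_mod_cast hj
      have : (0 : ℝ) ≤ x := x.cast_nonneg
      linarith
    calc (1 : ℝ) = α * α⁻¹ := (mul_inv_cancel₀ hα.ne').symm
      _ ≤ _ := by gcongr
  have hG := Real.rpow_mul_exp_neg_le_Gamma hs hR
  have hGpos : 0 < Real.Gamma (α * (x + 1 + j)) := Real.Gamma_pos_of_pos (by linarith)
  have hchoose : ((x + j).factorial : ℝ) ≤ 2 ^ (x + j) * x.factorial * j.factorial := by
    have h := Nat.add_choose_mul_factorial_mul_factorial x j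
    have h2 := Nat.choose_le_two_pow (x + j) j
    rw [← h]
    push_cast
    gcongr
    exact_mod_cast h2
  have hsplit : R ^ (α * (x + 1 + j) - 1) * Real.exp (-R) *
      (Real.exp R * R ^ (1 - α * (x + 1))) = (4 * μ) ^ j := by
    have h1 : R ^ (α * (x + 1 + j) - 1) * R ^ (1 - α * (x + 1)) = (4 * μ) ^ j := by
      rw [← Real.rpow_add hR, ← hRα, ← Real.rpow_natCast, ← Real.rpow_mul hR.le]
      congr 1
      ring
    rw [← h1, Real.exp_neg]
    field_simp
  rw [Real.norm_of_nonneg (by positivity), div_mul_div_comm, div_le_iff₀ (by positivity)]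
  calc μ ^ j * ((x + j).factorial : ℝ)
      ≤ μ ^ j * (2 ^ (x + j) * x.factorial * j.factorial) := by gcongr
    _ = (x.factorial : ℝ) * 2 ^ x * (1 / 2) ^ j * j.factorial * (4 * μ) ^ j := by
        rw [mul_pow, pow_add, show (4 : ℝ) = 2 * 2 by norm_num, mul_pow, one_div, inv_pow]
        field_simp
    _ = C * (1 / 2) ^ j * (j.factorial * (R ^ (α * (x + 1 + j) - 1) * Real.exp (-R))) := by
        rw [← hsplit, hC]
        ring
    _ ≤ _ := by gcongr

/-- Negative moments of a positive measure whose Laplace transform is `exp (-t ^ α)`. -/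
theorem lintegral_rpow_neg_of_laplace {α : ℝ} (hα : 0 < α) (ν : Measure ℝ)
    [IsProbabilityMeasure ν] (hpos : ∀ᵐ y ∂ν, 0 < y)
    (hlap : ∀ t : ℝ, 0 ≤ t → ∫ y, Real.exp (-(t * y)) ∂ν = Real.exp (-(t ^ α)))
    {s : ℝ} (hs : 0 < s) :
    ∫⁻ y, ENNReal.ofReal (y ^ (-s)) ∂ν =
      ENNReal.ofReal (Real.Gamma (s / α) / (α * Real.Gamma s)) := by
  have hGs : 0 < Real.Gamma s := Real.Gamma_pos_of_pos hs
  have hinner : ∀ᵐ y ∂ν, ENNReal.ofReal (y ^ (-s)) * ENNReal.ofReal (Real.Gamma s) =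
      ∫⁻ t in Set.Ioi (0 : ℝ), ENNReal.ofReal (t ^ (s - 1) * Real.exp (-(y * t))) := by
    filter_upwards [hpos] with y hy
    rw [← ofReal_integral_eq_lintegral_ofReal, Real.integral_rpow_mul_exp_neg_mul_Ioi hs hy,
      ← ENNReal.ofReal_mul (by positivity), Real.rpow_neg hy.le, one_div, Real.inv_rpow hy.le]
    -- A non-integrable function has integral `0` by convention, so a positive value of the integral
    -- forces integrability.
    · by_contra h
      have h0 := integral_undef h
      rw [Real.integral_rpow_mul_exp_neg_mul_Ioi hs hy] at h0
      exact absurd h0 (by positivity)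
    · filter_upwards [ae_restrict_mem measurableSet_Ioi] with t ht
      exact mul_nonneg (Real.rpow_nonneg (le_of_lt ht) _) (Real.exp_nonneg _)
  have houter : ∀ t ∈ Set.Ioi (0 : ℝ),
      ∫⁻ y, ENNReal.ofReal (t ^ (s - 1) * Real.exp (-(y * t))) ∂ν =
        ENNReal.ofReal (t ^ (s - 1) * Real.exp (-t ^ α)) := by
    intro t ht
    have ht' : 0 < t := ht
    have hl := hlap t ht'.le
    have hi : Integrable (fun y => Real.exp (-(t * y))) ν := by
      by_contra h
      rw [integral_undef h] at hl
      exact (Real.exp_pos _).ne hl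
    rw [← hl, ← integral_const_mul, ofReal_integral_eq_lintegral_ofReal (hi.const_mul _)]
    · simp only [mul_comm t]
    · exact Filter.Eventually.of_forall fun y => by positivity
  have hprod : ∫⁻ y, ENNReal.ofReal (y ^ (-s)) * ENNReal.ofReal (Real.Gamma s) ∂ν =
      ENNReal.ofReal (1 / α * Real.Gamma (s / α)) := by
    -- Tonelli: nonnegativity allows the swap before any moment is known to be finite.
    rw [lintegral_congr_ae hinner, lintegral_lintegral_swap (by
      apply Measurable.aemeasurable
      unfold Function.uncurry
      fun_prop), setLIntegral_congr_fun measurableSet_Ioi houter]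
    have hval := integral_rpow_mul_exp_neg_rpow hα (q := s - 1) (by linarith)
    rw [sub_add_cancel] at hval
    rw [← hval, ofReal_integral_eq_lintegral_ofReal]
    · by_contra h
      rw [integral_undef h] at hval
      have : 0 < Real.Gamma (s / α) := Real.Gamma_pos_of_pos (by positivity)
      exact absurd hval.symm (by positivity)
    · filter_upwards [ae_restrict_mem measurableSet_Ioi] with t ht
      exact mul_nonneg (Real.rpow_nonneg (le_of_lt ht) _) (Real.exp_nonneg _)
  rw [lintegral_mul_const _ (by fun_prop)] at hprod
  rw [← ENNReal.mul_left_inj (c := ENNReal.ofReal (Real.Gamma s)) (by simpa using hGs)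
    ENNReal.ofReal_ne_top, hprod, ← ENNReal.ofReal_mul' hGs.le]
  congr 1
  field_simp

theorem integrable_rpow_neg_of_laplace {α : ℝ} (hα : 0 < α) (ν : Measure ℝ)
    [IsProbabilityMeasure ν] (hpos : ∀ᵐ y ∂ν, 0 < y)
    (hlap : ∀ t : ℝ, 0 ≤ t → ∫ y, Real.exp (-(t * y)) ∂ν = Real.exp (-(t ^ α)))
    {s : ℝ} (hs : 0 < s) :
    Integrable (fun y : ℝ => y ^ (-s)) ν := by
  have hm : AEStronglyMeasurable (fun y : ℝ => y ^ (-s)) ν := by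
    apply Measurable.aestronglyMeasurable
    fun_prop
  refine ⟨hm, ?_⟩
  rw [hasFiniteIntegral_iff_ofReal (hpos.mono fun y hy => Real.rpow_nonneg hy.le _),
    lintegral_rpow_neg_of_laplace hα ν hpos hlap hs]
  exact ENNReal.ofReal_lt_top

theorem integral_rpow_neg_of_laplace {α : ℝ} (hα : 0 < α) (ν : Measure ℝ)
    [IsProbabilityMeasure ν] (hpos : ∀ᵐ y ∂ν, 0 < y)
    (hlap : ∀ t : ℝ, 0 ≤ t → ∫ y, Real.exp (-(t * y)) ∂ν = Real.exp (-(t ^ α)))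
    {s : ℝ} (hs : 0 < s) :
    ∫ y, y ^ (-s) ∂ν = Real.Gamma (s / α) / (α * Real.Gamma s) := by
  rw [integral_eq_lintegral_of_nonneg_ae (hpos.mono fun y hy => Real.rpow_nonneg hy.le _)
    (integrable_rpow_neg_of_laplace hα ν hpos hlap hs).aestronglyMeasurable,
    lintegral_rpow_neg_of_laplace hα ν hpos hlap hs, ENNReal.toReal_ofReal]
  have := Real.Gamma_pos_of_pos hs
  have := Real.Gamma_pos_of_pos (div_pos hs hα)
  positivity

/-- These exponents are the ones for which `s/α` is a positive integer, so `Γ(s/α)` is a factorial.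
-/
theorem integral_rpow_neg_mul_add_of_laplace {α : ℝ} (hα : 0 < α) (ν : Measure ℝ)
    [IsProbabilityMeasure ν] (hpos : ∀ᵐ y ∂ν, 0 < y)
    (hlap : ∀ t : ℝ, 0 ≤ t → ∫ y, Real.exp (-(t * y)) ∂ν = Real.exp (-(t ^ α))) (x j : ℕ) :
    ∫ y, y ^ (-(α * (x + 1 + j))) ∂ν =
      α⁻¹ * (((x + j).factorial : ℝ) / Real.Gamma (α * (x + 1 + j))) := by
  rw [integral_rpow_neg_of_laplace hα ν hpos hlap (by positivity), mul_div_cancel_left₀ _ hα.ne',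
    show (x : ℝ) + 1 + j = ((x + j : ℕ) : ℝ) + 1 by push_cast; ring, Real.Gamma_nat_eq_factorial]
  field_simp

/-- Termwise integration of the exponential series against a positive stable law. -/
theorem hasSum_integral_rpow_mul_exp_of_laplace {α μ : ℝ} (hα : 0 < α) (hμ : 0 < μ)
    (ν : Measure ℝ) [IsProbabilityMeasure ν] (hpos : ∀ᵐ y ∂ν, 0 < y)
    (hlap : ∀ t : ℝ, 0 ≤ t → ∫ y, Real.exp (-(t * y)) ∂ν = Real.exp (-(t ^ α))) (x : ℕ) :
    HasSum (fun j : ℕ => (-μ) ^ j / (j.factorial : ℝ) *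
        (α⁻¹ * (((x + j).factorial : ℝ) / Real.Gamma (α * (x + 1 + j)))))
      (∫ y, y ^ (-(α * (x + 1))) * Real.exp (-(μ * y ^ (-α))) ∂ν) := by
  have hmom := integral_rpow_neg_mul_add_of_laplace hα ν hpos hlap x
  have key := hasSum_integral_of_summable_integral_norm (μ := ν)
    (F := fun (j : ℕ) (y : ℝ) => (-μ) ^ j / (j.factorial : ℝ) * y ^ (-(α * (x + 1 + j))))
    (fun j => (integrable_rpow_neg_of_laplace hα ν hpos hlap (by positivity)).const_mul _) ?_
  · simp only [integral_const_mul, hmom] at key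
    have hseries : ∫ y, y ^ (-(α * ((x : ℝ) + 1))) * Real.exp (-(μ * y ^ (-α))) ∂ν =
        ∫ y, ∑' j : ℕ, (-μ) ^ j / (j.factorial : ℝ) * y ^ (-(α * ((x : ℝ) + 1 + j))) ∂ν := by
      refine integral_congr_ae (hpos.mono fun y hy => ?_)
      have hexp : HasSum (fun j : ℕ => (-(μ * y ^ (-α))) ^ j / (j.factorial : ℝ))
          (Real.exp (-(μ * y ^ (-α)))) := by
        rw [Real.exp_eq_exp_ℝ]
        exact NormedSpace.expSeries_div_hasSum_exp _
      refine Eq.trans (hexp.mul_left _).tsum_eq.symm (tsum_congr fun j => ?_)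
      rw [show -(α * ((x : ℝ) + 1 + j)) = -(α * (x + 1)) + -α * j by ring, Real.rpow_add hy,
        Real.rpow_mul_natCast hy.le, ← neg_mul μ, mul_pow]
      ring
    rwa [hseries]
  -- Taking norms only replaces `-μ` by `μ`, so the integrals of the norms are `α⁻¹` times the
  -- summable coefficients.
  · refine ((summable_factorial_mul_pow_div_Gamma hα hμ x).mul_left α⁻¹).congr fun j => ?_
    have hnorm : ∫ y, ‖(-μ) ^ j / (j.factorial : ℝ) * y ^ (-(α * (x + 1 + j)))‖ ∂ν =
        ∫ y, μ ^ j / (j.factorial : ℝ) * y ^ (-(α * (x + 1 + j))) ∂ν := by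
      refine integral_congr_ae (hpos.mono fun y hy => ?_)
      simp only [norm_mul, norm_div, norm_pow, norm_neg, Real.norm_natCast,
        Real.norm_of_nonneg hμ.le, Real.norm_of_nonneg (Real.rpow_nonneg hy.le _)]
    rw [hnorm, integral_const_mul, hmom]
    ring

theorem mainTheorem2 (α μ : ℝ) (hα0 : 0 < α) (hα1 : α ≤ 1) (hμ : 0 < μ)
    {Ω : Type*} [MeasurableSpace Ω] (P : Measure Ω) [IsProbabilityMeasure P]
    (X : Ω → ℕ) (hX : HasGfPd X P α α 1 μ)
    {Ω' : Type*} [MeasurableSpace Ω'] (P' : Measure Ω') [IsProbabilityMeasure P']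
    (S : Ω' → ℝ) (hS : IsPositiveStable S P' α) (x : ℕ) :
    IntegrableOn (fun y : ℝ => y ^ (-(α * (x + 1))) * Real.exp (-(μ * y ^ (-α))))
      (Set.Ioi 0) (P'.map S) ∧
    P.real {ω | X ω = x} =
      Real.Gamma (α + 1) * (μ ^ x / (x.factorial : ℝ)) *
        ∫ y in Set.Ioi (0 : ℝ), y ^ (-(α * (x + 1))) * Real.exp (-(μ * y ^ (-α)))
          ∂(P'.map S) := by
  have hprob : IsProbabilityMeasure (P'.map S) := Measure.isProbabilityMeasure_map hS.aemeasurable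
  have hpos : ∀ᵐ y ∂(P'.map S), 0 < y :=
    (ae_map_iff hS.aemeasurable measurableSet_Ioi).2 hS.pos
  have hlap : ∀ t : ℝ, 0 ≤ t →
      ∫ y, Real.exp (-(t * y)) ∂(P'.map S) = Real.exp (-(t ^ α)) := fun t ht => by
    rw [integral_map hS.aemeasurable (by fun_prop), hS.laplace t ht]
  have hrestrict : (P'.map S).restrict (Set.Ioi 0) = P'.map S :=
    Measure.restrict_eq_self_of_ae_mem hpos
  rw [IntegrableOn, hrestrict]
  constructor
  -- The exponential factor is at most `1`, so a negative moment dominates.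
  · refine (integrable_rpow_neg_of_laplace hα0 _ hpos hlap
      (s := α * (x + 1)) (by positivity)).mono' ?_ (hpos.mono fun y hy => ?_)
    · apply Measurable.aestronglyMeasurable
      fun_prop
    · have hy1 : 0 ≤ y ^ (-(α * ((x : ℝ) + 1))) := Real.rpow_nonneg hy.le _
      have hy2 : 0 ≤ y ^ (-α) := Real.rpow_nonneg hy.le _
      rw [Real.norm_of_nonneg (by positivity)]
      refine mul_le_of_le_one_right hy1 (Real.exp_le_one_iff.2 ?_)
      have := mul_nonneg hμ.le hy2
      linarith
  -- The `α` from `Γ(α+1) = α Γ(α)` cancels the `α⁻¹` in each moment, and `Γ(1+x)` in the mass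
  -- cancels the denominator of `(1+x)_j`.
  · rw [hX.mass x, gfPdMass, mittagLeffler,
      ← (hasSum_integral_rpow_mul_exp_of_laplace hα0 hμ _ hpos hlap x).tsum_eq,
      Real.Gamma_add_one hα0.ne', ← tsum_mul_left, ← tsum_mul_left]
    refine tsum_congr fun j => ?_
    have hx : Real.Gamma (1 + (x : ℝ)) = x.factorial := by
      rw [add_comm, Real.Gamma_nat_eq_factorial]
    have hxj : Real.Gamma (1 + (x : ℝ) + j) = (x + j).factorial := by
      rw [show 1 + (x : ℝ) + j = ((x + j : ℕ) : ℝ) + 1 by push_cast; ring,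
        Real.Gamma_nat_eq_factorial]
    have harg : α * j + (α * x + α) = α * (x + 1 + j) := by ring
    have hG : Real.Gamma (α * (x + 1 + j)) ≠ 0 := (Real.Gamma_pos_of_pos (by positivity)).ne'
    rw [hx, hxj, harg, Real.Gamma_one]
    field_simp
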